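/- Work over $\mathbb{C}$. For $d\ge 0$ let $L_d=\frac{d(d+3)}{2}$ and let $\mathbb{P}^{L_d}$ be the projective space whose points $[c_{ijk}]_{i+j+k=d}$ correspond to the plane curves of degree $d$, given by $\sum_{i+j+k=d}c_{ijk}X^iY^jZ^k=0$ in $\mathbb{P}^2$. A node of a plane curve is an ordinary double point, i.e. a point at which, in affine coordinates centred at the point, the lowest-order term of the equation has degree two and is a product of two non-proportional linear forms. For $n\ge 0$ let $B_{d,n}\subseteq\mathbb{P}^{L_d}$ be the set of irreducible reduced curves with at least $n$ distinct nodes, and let $D_{d,n}\subseteq\mathbb{P}^{L_d}$ be the set of irreducible reduced curves with exactly $n$ distinct nodes (other singularities are allowed in both cases). In $\mathbb{P}^{L_d}\times(\mathbb{P}^2)^n$ put $$H_{d,n}:=\{(C,p_1,\dots,p_n)\mid C\in B_{d,n},\ p_1,\dots,p_n\text{ are distinct nodes of }C\},$$ $$K_{d,n}:=\{(C,p_1,\dots,p_n)\mid C\in D_{d,n},\ p_1,\dots,p_n\text{ are distinct nodes of }C\}.$$ Then, for the Zariski topologies of $\mathbb{P}^{L_d}\times(\mathbb{P}^2)^n$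 and $\mathbb{P}^{L_d}$, the sets $H_{d,n}$, $K_{d,n}$, $B_{d,n}$ and $D_{d,n}$ are constructible, i.e. finite Boolean combinations of Zariski open sets. -/

import Mathlib

open MvPolynomial
open scoped LinearAlgebra.Projectivization

noncomputable section

namespace PlaneNodal

/-! ### Zariski topologies on projective and multiprojective spaces over `ℂ` -/

/-- Common zeros of a set `S` of polynomials in the variables `ι`, for points `x : X` having
coordinate vector `r x : ι → ℂ`. -/
def zeroLocus {X ι : Type} (r : X → ι → ℂ) (S : Set (MvPolynomial ι ℂ)) : Set X :=
  {x | ∀ f ∈ S, eval (r x) f = 0}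

/-- The topology on `X` whose closed sets are the common zeros of arbitrary sets of polynomials
that are homogeneous for the grading in which the variable `i` has weight `w i`. The points are
given by homogeneous coordinates `r`. -/
abbrev zariskiTopology {X ι M : Type} [AddCommMonoid M] (w : ι → M) (r : X → ι → ℂ) :
    TopologicalSpace X :=
  TopologicalSpace.ofClosed
    {Z | ∃ S : Set (MvPolynomial ι ℂ),
      (∀ f ∈ S, ∃ m : M, IsWeightedHomogeneous w f m) ∧ Z = zeroLocus r S}
    ⟨{1}, by
      rintro f rfl
      exact ⟨0, isWeightedHomogeneous_one ℂ w⟩, by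
      ext x; simp [zeroLocus]⟩
    (by
      intro A hA
      refine ⟨{f | (∃ m : M, IsWeightedHomogeneous w f m) ∧
        ∃ Z ∈ A, ∀ x ∈ Z, eval (r x) f = 0}, fun f hf => hf.1, ?_⟩
      ext x
      constructor
      · rintro hx f ⟨-, Z, hZ, hf⟩
        exact hf x (hx Z hZ)
      · intro hx Z hZ
        obtain ⟨S, hS, rfl⟩ := hA hZ
        intro f hf
        exact hx f ⟨hS f hf, _, hZ, fun y hy => hy f hf⟩)
    (by
      rintro _ ⟨S, hS, rfl⟩ _ ⟨T, hT, rfl⟩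
      refine ⟨{h | ∃ f ∈ S, ∃ g ∈ T, h = f * g}, ?_, ?_⟩
      · rintro _ ⟨f, hf, g, hg, rfl⟩
        obtain ⟨m, hm⟩ := hS f hf
        obtain ⟨k, hk⟩ := hT g hg
        exact ⟨m + k, hm.mul hk⟩
      · ext x
        constructor
        · rintro (hx | hx) _ ⟨f, hf, g, hg, rfl⟩
          · simp [hx f hf]
          · simp [hx g hg]
        · intro hx
          by_contra hcon
          simp only [Set.mem_union, not_or, zeroLocus, Set.mem_ofPred_eq, not_forall] at hcon
          obtain ⟨⟨f, hf, hf0⟩, g, hg, hg0⟩ := hcon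
          have := hx _ ⟨f, hf, g, hg, rfl⟩
          rw [map_mul] at this
          exact (mul_ne_zero hf0 hg0) this)

/-- The projective plane over `ℂ`. -/
abbrev Plane : Type := ℙ ℂ (Fin 3 → ℂ)

/-- Exponents `(i, j, k)` of the monomials of degree `d` in three variables. -/
abbrev Exponent (d : ℕ) : Type :=
  {m : Fin 3 →₀ ℕ // m ∈ (Finset.univ : Finset (Fin 3)).finsuppAntidiag d}

/-- The space of plane curves of degree `d`: a point `[c_{ijk}]` is the curve given by
`∑ c_{ijk} X^i Y^j Z^k`. There are `d (d + 3) / 2 + 1` exponents. -/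
def CurveSpace (d : ℕ) : Type := ℙ ℂ (Exponent d → ℂ)

/-- The product of `CurveSpace d` with `n` copies of the projective plane. -/
def IncidenceSpace (d n : ℕ) : Type := CurveSpace d × (Fin n → Plane)

/-- A vector of homogeneous coefficients of a curve. -/
def CurveSpace.coeffs {d : ℕ} (C : CurveSpace d) : Exponent d → ℂ :=
  Projectivization.rep (K := ℂ) (V := Exponent d → ℂ) C

/-- Closed sets are the zero loci of sets of homogeneous polynomials. -/
instance (d : ℕ) : TopologicalSpace (CurveSpace d) :=
  zariskiTopology (M := ℕ) (fun _ : Exponent d => 1) CurveSpace.coeffs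

/-- Homogeneous coordinates of a point of the product space. -/
def IncidenceSpace.coords {d n : ℕ} (x : IncidenceSpace d n) :
    Exponent d ⊕ (Fin n × Fin 3) → ℂ :=
  Sum.elim x.1.coeffs (fun q => (x.2 q.1).rep q.2)

/-- The multidegrees of the variables: one degree for the coefficients of the curve, and one
degree for each of the `n` points. -/
def IncidenceSpace.weight (d n : ℕ) : Exponent d ⊕ (Fin n × Fin 3) → ℕ × (Fin n → ℕ) :=
  Sum.elim (fun _ => (1, 0)) (fun q => (0, Pi.single q.1 1))

/-- The Zariski topology of the product variety (not the product topology): closed sets are the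
zero loci of sets of multihomogeneous polynomials. -/
instance (d n : ℕ) : TopologicalSpace (IncidenceSpace d n) :=
  zariskiTopology (IncidenceSpace.weight d n) IncidenceSpace.coords

/-! ### Nodes -/

/-- The homogeneous equation of a plane curve (well defined up to a nonzero scalar). -/
def CurveSpace.form {d : ℕ} (C : CurveSpace d) : MvPolynomial (Fin 3) ℂ :=
  ∑ m : Exponent d, monomial m.1 (C.coeffs m)

/-- The curve is irreducible and reduced, i.e. its equation is an irreducible polynomial. -/
def CurveSpace.IsIntegral {d : ℕ} (C : CurveSpace d) : Prop := Irreducible C.form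

/-- The equation of `F = 0` in the affine chart `x_k = 1` of the plane, translated so that the
point `p` (which is assumed to lie in the chart) becomes the origin. -/
def localEquation (F : MvPolynomial (Fin 3) ℂ) (k : Fin 3) (p : Plane) :
    MvPolynomial (Fin 2) ℂ :=
  aeval (k.insertNth (α := fun _ => MvPolynomial (Fin 2) ℂ) 1
    (fun j => X j + C (p.rep (k.succAbove j) / p.rep k))) F

/-- The origin is an ordinary double point of `g = 0`: the lowest-order term of `g` has degree
two and is the product of two non-proportional linear forms. -/
def IsOrdinaryDoublePoint (g : MvPolynomial (Fin 2) ℂ) : Prop :=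
  homogeneousComponent 0 g = 0 ∧ homogeneousComponent 1 g = 0 ∧
    ∃ a b : Fin 2 → ℂ, LinearIndependent ℂ ![a, b] ∧
      homogeneousComponent 2 g = (∑ i, C (a i) * X i) * (∑ i, C (b i) * X i)

/-- The set of nodes of a plane curve, tested in an affine chart around the point. -/
def CurveSpace.nodes {d : ℕ} (C : CurveSpace d) : Set Plane :=
  {p | ∃ k : Fin 3, p.rep k ≠ 0 ∧ IsOrdinaryDoublePoint (localEquation C.form k p)}

/-! ### The sets of nodal curves -/

/-- Irreducible reduced curves of degree `d` with at least `n` nodes. -/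
def setB (d n : ℕ) : Set (CurveSpace d) := {C | C.IsIntegral ∧ (n : ℕ∞) ≤ C.nodes.encard}

/-- Irreducible reduced curves of degree `d` with exactly `n` nodes. -/
def setD (d n : ℕ) : Set (CurveSpace d) := {C | C.IsIntegral ∧ C.nodes.encard = n}

/-- Curves in `setB d n` together with `n` distinct nodes. -/
def setH (d n : ℕ) : Set (IncidenceSpace d n) :=
  {x | x.1 ∈ setB d n ∧ Function.Injective x.2 ∧ ∀ i, x.2 i ∈ x.1.nodes}

/-- Curves in `setD d n` together with `n` distinct nodes. -/
def setK (d n : ℕ) : Set (IncidenceSpace d n) :=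
  {x | x.1 ∈ setD d n ∧ Function.Injective x.2 ∧ ∀ i, x.2 i ∈ x.1.nodes}

end PlaneNodal

end

/-!
The four sets are defined by first-order conditions on homogeneous coordinates, so constructibility
is a matter of eliminating quantifiers over `ℂ` in affine space and then descending to
(multi)projective space.

*Elimination.* `IsAffineConstructible` is constructibility of a set of `ℂ`-points of affine space,
expressed through the spectrum of the polynomial ring. By Chevalley's theorem and the
Nullstellensatz such sets are stable under projections (`IsAffineConstructible.exists`).
Irreducibility of a polynomial of bounded degree is the negation of a statement that quantifies
over the finitely many coefficients of two factors (`isAffineConstructible_irreducible`). Being a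
node is an existential statement over the affine coordinates of the point and the coefficients of
the two tangent forms (`isAffineConstructible_isNodeAt`). Hence the cone `coneH` over `setH` and
its projection `coneB` are constructible, and `setD d n = setB d n \ setB d (n + 1)`.

*Descent.* On the open set where a chosen homogeneous polynomial `u` does not vanish, the quotients
by `u` of homogeneous polynomials of the same degree do not depend on the choice of homogeneous
coordinates, and any polynomial in them becomes homogeneous after multiplication with a power of
`u`. A subset which is described by an affine constructible condition in every such chart is
therefore constructible (`isConstructible_of_charts`). Every open set of these Zariski topologies
is retrocompact because the spaces are Noetherian (`noetherianSpace_zariskiTopology`).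
-/

open scoped Topology

noncomputable section

namespace PlaneNodal

/-! ### Zariski topologies are Noetherian -/

section Zariski

variable {X ι M : Type} [AddCommMonoid M] (w : ι → M) (r : X → ι → ℂ)

lemma isClosed_zariskiTopology_iff {Z : Set X} :
    IsClosed[zariskiTopology w r] Z ↔ ∃ S : Set (MvPolynomial ι ℂ),
      (∀ f ∈ S, ∃ m : M, IsWeightedHomogeneous w f m) ∧ Z = zeroLocus r S := by
  let _ := zariskiTopology w r
  rw [← isOpen_compl_iff]
  change Zᶜᶜ ∈ {Z : Set X | _} ↔ _
  rw [compl_compl]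
  rfl

lemma isClosed_zariskiTopology {f : MvPolynomial ι ℂ} {m : M} (hf : IsWeightedHomogeneous w f m) :
    IsClosed[zariskiTopology w r] {x | eval (r x) f = 0} := by
  refine (isClosed_zariskiTopology_iff w r).2 ⟨{f}, ?_, ?_⟩
  · rintro _ rfl
    exact ⟨m, hf⟩
  · ext x
    simp [zeroLocus]

/-- A closed set is determined by the ideal of all polynomials vanishing on it, so the descending
chain condition follows from Hilbert's basis theorem. -/
lemma noetherianSpace_zariskiTopology [Finite ι] :
    @TopologicalSpace.NoetherianSpace X (zariskiTopology w r) := by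
  let _ := zariskiTopology w r
  let I : TopologicalSpace.Closeds X → Ideal (MvPolynomial ι ℂ) := fun Z =>
    ⨅ x ∈ (Z : Set X), RingHom.ker (eval (r x))
  have hmem (Z : TopologicalSpace.Closeds X) (f : MvPolynomial ι ℂ) :
      f ∈ I Z ↔ ∀ x ∈ Z, eval (r x) f = 0 := by
    simp [I, Submodule.mem_iInf, RingHom.mem_ker]
  have hI : ∀ Z Z' : TopologicalSpace.Closeds X, I Z' ≤ I Z → Z ≤ Z' := by
    intro Z Z' h x hx
    obtain ⟨S, -, hZ'⟩ := (isClosed_zariskiTopology_iff w r).1 Z'.isClosed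
    change x ∈ (Z' : Set X)
    rw [hZ']
    intro f hf
    refine (hmem Z f).1 (h ((hmem Z' f).2 fun y hy => ?_)) x hx
    have hy' : y ∈ (Z' : Set X) := hy
    rw [hZ'] at hy'
    exact hy' f hf
  have hanti : StrictAnti I := by
    intro Z Z' hlt
    refine lt_of_le_of_ne (fun f hf => (hmem _ _).2 fun x hx => (hmem _ _).1 hf x (hlt.le hx)) ?_
    intro h
    exact hlt.not_ge (hI _ _ h.ge)
  have : WellFoundedLT (TopologicalSpace.Closeds X) :=
    hanti.wellFoundedLT
  exact ((TopologicalSpace.noetherianSpace_TFAE X).out 0 1).2 this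

end Zariski

lemma _root_.IsClosed.isConstructible_of_noetherianSpace {X : Type*} [TopologicalSpace X]
    [TopologicalSpace.NoetherianSpace X] {Z : Set X} (hZ : IsClosed Z) :
    Topology.IsConstructible Z := by
  rw [← Topology.isConstructible_compl]
  exact IsRetrocompact.isConstructible hZ.isOpen_compl
    fun _ _ _ => TopologicalSpace.NoetherianSpace.isCompact _

/-! ### Constructible subsets of affine space -/

section Affine

variable {ι κ σ : Type}

/-- A set of points of the affine space `ι → ℂ` is constructible if it consists of the
`ℂ`-points of a constructible subset of `Spec ℂ[ι]`. Passing through the spectrum gives access to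
Chevalley's theorem. -/
def IsAffineConstructible (S : Set (ι → ℂ)) : Prop :=
  ∃ T : Set (PrimeSpectrum (MvPolynomial ι ℂ)), Topology.IsConstructible T ∧
    S = pointToPoint (k := ℂ) ⁻¹' T

lemma comap_rename_pointToPoint (e : κ → ι) (x : ι → ℂ) :
    PrimeSpectrum.comap (rename (R := ℂ) e : MvPolynomial κ ℂ →+* MvPolynomial ι ℂ)
        (pointToPoint (k := ℂ) x) =
      pointToPoint (k := ℂ) (x ∘ e) := by
  ext f
  simp [pointToPoint, aeval_rename]

namespace IsAffineConstructible

lemma compl {S : Set (ι → ℂ)} (hS : IsAffineConstructible S) : IsAffineConstructible Sᶜ := by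
  obtain ⟨T, hT, rfl⟩ := hS
  exact ⟨Tᶜ, hT.compl, rfl⟩

lemma inter {S S' : Set (ι → ℂ)} (hS : IsAffineConstructible S) (hS' : IsAffineConstructible S') :
    IsAffineConstructible (S ∩ S') := by
  obtain ⟨T, hT, rfl⟩ := hS
  obtain ⟨T', hT', rfl⟩ := hS'
  exact ⟨T ∩ T', hT.inter hT', rfl⟩

lemma iInter {J : Type} [Finite J] {S : J → Set (ι → ℂ)}
    (hS : ∀ j, IsAffineConstructible (S j)) : IsAffineConstructible (⋂ j, S j) := by
  choose T hT h using hS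
  refine ⟨⋂ j, T j, .iInter hT, ?_⟩
  simp [h, Set.preimage_iInter]

lemma iUnion {J : Type} [Finite J] {S : J → Set (ι → ℂ)}
    (hS : ∀ j, IsAffineConstructible (S j)) : IsAffineConstructible (⋃ j, S j) := by
  choose T hT h using hS
  refine ⟨⋃ j, T j, .iUnion hT, ?_⟩
  simp [h]

/-- The zero set of an arbitrary family of polynomials. -/
lemma zeros [Finite ι] {J : Type} (f : J → MvPolynomial ι ℂ) :
    IsAffineConstructible {x | ∀ j, eval x (f j) = 0} := by
  refine ⟨PrimeSpectrum.zeroLocus (Set.range f),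
    (PrimeSpectrum.isClosed_zeroLocus _).isConstructible_of_noetherianSpace, ?_⟩
  ext x
  simp [PrimeSpectrum.mem_zeroLocus, Set.range_subset_iff, pointToPoint,
    aeval_eq_eval]

lemma reindex [Finite ι] {S : Set (κ → ℂ)} (hS : IsAffineConstructible S) (e : κ → ι) :
    IsAffineConstructible {x : ι → ℂ | x ∘ e ∈ S} := by
  obtain ⟨T, hT, rfl⟩ := hS
  refine ⟨PrimeSpectrum.comap
    (rename (R := ℂ) e : MvPolynomial κ ℂ →+* MvPolynomial ι ℂ) ⁻¹' T, ?_, ?_⟩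
  · exact hT.preimage (PrimeSpectrum.continuous_comap _)
      fun _ _ _ _ _ _ => TopologicalSpace.NoetherianSpace.isCompact _
  · ext x
    simp [comap_rename_pointToPoint]

end IsAffineConstructible

/-- A point of a constructible set has a locally closed neighbourhood on which membership in the
set is constant. -/
lemma _root_.Topology.IsConstructible.exists_isLocallyClosed {X : Type*} [TopologicalSpace X]
    {T : Set X} (hT : Topology.IsConstructible T) (p : X) :
    ∃ L, IsLocallyClosed L ∧ p ∈ L ∧ (L ⊆ T ∨ L ⊆ Tᶜ) := by
  induction hT using Topology.IsConstructible.empty_union_induction with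
  | open_retrocompact U hU _ =>
    by_cases hp : p ∈ U
    · exact ⟨U, hU.isLocallyClosed, hp, .inl subset_rfl⟩
    · exact ⟨Uᶜ, hU.isClosed_compl.isLocallyClosed, hp, .inr subset_rfl⟩
  | union s _ t _ hs ht =>
    obtain ⟨L, hL, hpL, h⟩ := hs
    obtain ⟨L', hL', hpL', h'⟩ := ht
    refine ⟨L ∩ L', hL.inter hL', ⟨hpL, hpL'⟩, ?_⟩
    rw [Set.compl_union]
    rcases h with h | h
    · exact .inl fun x hx => .inl (h hx.1)
    rcases h' with h' | h'
    · exact .inl fun x hx => .inr (h' hx.2)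
    · exact .inr fun x hx => ⟨h hx.1, h' hx.2⟩
  | compl s _ hs =>
    obtain ⟨L, hL, hpL, h⟩ := hs
    exact ⟨L, hL, hpL, by rw [compl_compl]; exact h.symm⟩

/-- In `Spec` of a Jacobson ring, every point of a constructible set specializes to a closed
point of the same set. -/
lemma exists_isMaximal_ge_of_mem_isConstructible {R : Type*} [CommRing R] [IsJacobsonRing R]
    {T : Set (PrimeSpectrum R)} (hT : Topology.IsConstructible T) {P : PrimeSpectrum R}
    (hP : P ∈ T) : ∃ Q ∈ T, Q.asIdeal.IsMaximal ∧ P.asIdeal ≤ Q.asIdeal := by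
  obtain ⟨L, hL, hPL, h⟩ := hT.exists_isLocallyClosed P
  obtain ⟨Q, ⟨hQL, hQ⟩, hQmax⟩ := nonempty_inter_closedPoints
    (Z := L ∩ closure {P}) ⟨P, hPL, subset_closure rfl⟩
    (hL.inter isClosed_closure.isLocallyClosed)
  refine ⟨Q, (h.resolve_right fun h' => h' hPL hP) hQL, ?_, ?_⟩
  · exact (PrimeSpectrum.isClosed_singleton_iff_isMaximal Q).1 hQmax
  · exact (PrimeSpectrum.le_iff_mem_closure P Q).2 hQ

/-- Chevalley's theorem on `ℂ`-points: the projection of a constructible set is constructible.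
A `ℂ`-point of the projection on the level of spectra lifts to a point of the given set, which
specializes inside the set to a maximal ideal. That is again a `ℂ`-point, by the
Nullstellensatz, and it lies over the same point of the base. -/
lemma IsAffineConstructible.exists [Finite ι] [Finite κ] {S : Set (ι ⊕ κ → ℂ)}
    (hS : IsAffineConstructible S) :
    IsAffineConstructible {x : ι → ℂ | ∃ y : κ → ℂ, Sum.elim x y ∈ S} := by
  obtain ⟨T, hT, rfl⟩ := hS
  let φ : MvPolynomial ι ℂ →+* MvPolynomial (ι ⊕ κ) ℂ :=
    (rename (R := ℂ) (Sum.inl : ι → ι ⊕ κ) : MvPolynomial ι ℂ →ₐ[ℂ] MvPolynomial (ι ⊕ κ) ℂ)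
  have hφ : φ.FinitePresentation := by
    refine RingHom.FinitePresentation.of_finiteType.1 ?_
    refine RingHom.FiniteType.of_comp_finiteType (f := algebraMap ℂ (MvPolynomial ι ℂ)) ?_
    have : φ.comp (algebraMap ℂ (MvPolynomial ι ℂ)) = algebraMap ℂ (MvPolynomial (ι ⊕ κ) ℂ) :=
      AlgHom.comp_algebraMap _
    rw [this, RingHom.finiteType_algebraMap]
    infer_instance
  refine ⟨_, PrimeSpectrum.isConstructible_comap_image hφ hT, ?_⟩
  ext x
  constructor
  · rintro ⟨y, hy⟩
    exact ⟨_, hy, comap_rename_pointToPoint _ _⟩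
  · rintro ⟨P, hP, hPx⟩
    obtain ⟨Q, hQ, hQmax, hPQ⟩ := exists_isMaximal_ge_of_mem_isConstructible hT hP
    obtain ⟨z, hz⟩ := isMaximal_iff_eq_vanishingIdeal_singleton.1 hQmax
    obtain rfl : Q = pointToPoint (k := ℂ) z := PrimeSpectrum.ext hz
    refine ⟨z ∘ Sum.inr, ?_⟩
    have hx : z ∘ Sum.inl = x := by
      funext i
      have h1 : (X i - C (x i) : MvPolynomial ι ℂ) ∈ (pointToPoint (k := ℂ) x).asIdeal := by
        simp [pointToPoint]
      rw [← hPx] at h1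
      have h2 := hPQ h1
      simpa [φ, pointToPoint, mem_vanishingIdeal_singleton_iff, sub_eq_zero] using h2
    rw [← hx, Sum.elim_comp_inl_inr]
    exact hQ

end Affine

/-! ### From affine cones to multiprojective spaces -/

section Descent

variable {X ι κ M : Type} [AddCommMonoid M] {w : ι → M}

/-- Homogenization. If `u` and all `G k` are homogeneous of the same degree, then a polynomial
`f` in the quotients `G k / u` becomes homogeneous after multiplication with a high power of
`u`. -/
lemma exists_homogenization {W : M} {u : MvPolynomial ι ℂ} {G : κ → MvPolynomial ι ℂ}
    (hu : IsWeightedHomogeneous w u W) (hG : ∀ k, IsWeightedHomogeneous w (G k) W)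
    (f : MvPolynomial κ ℂ) : ∃ N₀ : ℕ, ∀ N ≥ N₀, ∃ F, IsWeightedHomogeneous w F (N • W) ∧
      ∀ x, eval x u ≠ 0 →
        eval x F = eval x u ^ N * eval (fun k => eval x (G k) / eval x u) f := by
  induction f using MvPolynomial.induction_on with
  | C a =>
    refine ⟨0, fun N _ => ⟨C a * u ^ N, ?_, fun x _ => by simp [mul_comm]⟩⟩
    simpa using (isWeightedHomogeneous_C w a).mul (hu.pow N)
  | add p q hp hq =>
    obtain ⟨N₁, h₁⟩ := hp
    obtain ⟨N₂, h₂⟩ := hq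
    refine ⟨max N₁ N₂, fun N hN => ?_⟩
    obtain ⟨F₁, hF₁, e₁⟩ := h₁ N (le_of_max_le_left hN)
    obtain ⟨F₂, hF₂, e₂⟩ := h₂ N (le_of_max_le_right hN)
    exact ⟨F₁ + F₂, hF₁.add hF₂, fun x hx => by simp [e₁ x hx, e₂ x hx, mul_add]⟩
  | mul_X p k hp =>
    obtain ⟨N₁, h₁⟩ := hp
    refine ⟨N₁ + 1, fun N hN => ?_⟩
    obtain ⟨N, rfl⟩ : ∃ N', N = N' + 1 := ⟨N - 1, by omega⟩
    obtain ⟨F, hF, e⟩ := h₁ N (by omega)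
    refine ⟨F * G k, by simpa [succ_nsmul] using hF.mul (hG k), fun x hx => ?_⟩
    simp only [map_mul, e x hx, eval_X]
    field_simp
    ring

/-- Descent of constructibility from affine space. The points of `X` are covered by charts
`u c ≠ 0`, in each of which the functions `G c k / u c` of degree zero are affine coordinates. A
subset of `X` which in these coordinates is cut out by an affine constructible set is
constructible. -/
lemma isConstructible_of_charts [Finite ι] {r : X → ι → ℂ} {J : Type} [Finite J] {W : J → M}
    {u : J → MvPolynomial ι ℂ} {G : J → κ → MvPolynomial ι ℂ}
    (hu : ∀ c, IsWeightedHomogeneous w (u c) (W c))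
    (hG : ∀ c k, IsWeightedHomogeneous w (G c k) (W c))
    (hcov : ∀ x, ∃ c, eval (r x) (u c) ≠ 0)
    {S : Set X} {Ŝ : Set (κ → ℂ)} (hŜ : IsAffineConstructible Ŝ)
    (hS : ∀ x c, eval (r x) (u c) ≠ 0 →
      (x ∈ S ↔ (fun k => eval (r x) (G c k) / eval (r x) (u c)) ∈ Ŝ)) :
    @Topology.IsConstructible X (zariskiTopology w r) S := by
  let _ := zariskiTopology w r
  have _ : TopologicalSpace.NoetherianSpace X := noetherianSpace_zariskiTopology w r
  let U : J → Set X := fun c => {x | eval (r x) (u c) = 0}ᶜ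
  have hU (c : J) : Topology.IsConstructible (U c) :=
    (isClosed_zariskiTopology w r (hu c)).isConstructible_of_noetherianSpace.compl
  let ν : J → X → κ → ℂ := fun c x k => eval (r x) (G c k) / eval (r x) (u c)
  have key (c : J) {T : Set (PrimeSpectrum (MvPolynomial κ ℂ))} (hT : Topology.IsConstructible T) :
      Topology.IsConstructible (U c ∩ {x | pointToPoint (k := ℂ) (ν c x) ∈ T}) := by
    induction hT using Topology.IsConstructible.empty_union_induction with
    | open_retrocompact V hV _ =>
      obtain ⟨s, hs⟩ := (PrimeSpectrum.isOpen_iff V).1 hV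
      have h1 (f : MvPolynomial κ ℂ) : ∃ (m : M) (F : MvPolynomial ι ℂ),
          IsWeightedHomogeneous w F m ∧
            ∀ x ∈ U c, (eval (r x) F = 0 ↔ eval (ν c x) f = 0) := by
        obtain ⟨N, hN⟩ := exists_homogenization (hu c) (hG c) f
        obtain ⟨F, hF, e⟩ := hN N le_rfl
        refine ⟨_, F, hF, fun x hx => ?_⟩
        rw [e _ hx, mul_eq_zero, or_iff_right (pow_ne_zero _ hx)]
      choose m F hF e using h1
      have hclosed : IsClosed (⋂ f ∈ s, {x | eval (r x) (F f) = 0}) :=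
        isClosed_biInter fun f _ => isClosed_zariskiTopology w r (hF f)
      convert! (hU c).inter hclosed.isConstructible_of_noetherianSpace.compl using 1
      ext x
      refine and_congr_right fun hx => ?_
      rw [Set.mem_ofPred_eq, ← Set.notMem_compl_iff, hs, Set.mem_compl_iff, not_iff_not,
        PrimeSpectrum.mem_zeroLocus]
      simp only [Set.mem_iInter, Set.mem_ofPred_eq, e _ x hx]
      simp [Set.subset_def, pointToPoint, aeval_eq_eval]
    | union s _ t _ hs ht =>
      convert! hs.union ht using 1
      rw [← Set.inter_union_distrib_left]
      rfl
    | compl s _ hs =>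
      convert! (hU c).inter hs.compl using 1
      ext x
      simp only [Set.mem_inter_iff, Set.mem_compl_iff, Set.mem_ofPred_eq]
      tauto
  obtain ⟨T, hT, rfl⟩ := hŜ
  convert! Topology.IsConstructible.iUnion fun c => key c hT using 1
  ext x
  simp only [Set.mem_iUnion]
  constructor
  · intro hx
    obtain ⟨c, hc⟩ := hcov x
    exact ⟨c, hc, (hS x c hc).1 hx⟩
  · rintro ⟨c, hc, hx⟩
    exact (hS x c hc).2 hx

end Descent

/-! ### Polynomials depending polynomially on parameters -/

section Families

variable {ι κ σ τ : Type}

/-- A family of polynomials in the variables `σ`, indexed by the points of `ι → ℂ`, whose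
coefficients are polynomial functions of the parameter. -/
def IsPolynomialFamily (G : (ι → ℂ) → MvPolynomial σ ℂ) : Prop :=
  ∃ P : MvPolynomial σ (MvPolynomial ι ℂ), ∀ x, G x = map (eval x) P

namespace IsPolynomialFamily

variable {G H : (ι → ℂ) → MvPolynomial σ ℂ}

lemma const (p : MvPolynomial σ ℂ) : IsPolynomialFamily fun _ : ι → ℂ => p := by
  refine ⟨map C p, fun x => ?_⟩
  rw [map_map]
  have : (eval x).comp C = RingHom.id ℂ := by ext; simp
  rw [this, map_id]

lemma coord (i : ι) : IsPolynomialFamily fun x : ι → ℂ => (C (x i) : MvPolynomial σ ℂ) :=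
  ⟨C (X i), fun x => by simp⟩

lemma add (hG : IsPolynomialFamily G) (hH : IsPolynomialFamily H) :
    IsPolynomialFamily fun x => G x + H x := by
  obtain ⟨P, hP⟩ := hG
  obtain ⟨Q, hQ⟩ := hH
  exact ⟨P + Q, fun x => by simp [hP, hQ]⟩

lemma sub (hG : IsPolynomialFamily G) (hH : IsPolynomialFamily H) :
    IsPolynomialFamily fun x => G x - H x := by
  obtain ⟨P, hP⟩ := hG
  obtain ⟨Q, hQ⟩ := hH
  exact ⟨P - Q, fun x => by simp [hP, hQ]⟩

lemma mul (hG : IsPolynomialFamily G) (hH : IsPolynomialFamily H) :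
    IsPolynomialFamily fun x => G x * H x := by
  obtain ⟨P, hP⟩ := hG
  obtain ⟨Q, hQ⟩ := hH
  exact ⟨P * Q, fun x => by simp [hP, hQ]⟩

lemma sum {J : Type} [Fintype J] {G : J → (ι → ℂ) → MvPolynomial σ ℂ}
    (hG : ∀ j, IsPolynomialFamily (G j)) : IsPolynomialFamily fun x => ∑ j, G j x := by
  choose P hP using hG
  exact ⟨∑ j, P j, fun x => by simp [hP]⟩

lemma aeval (hG : IsPolynomialFamily G) {K : σ → (ι → ℂ) → MvPolynomial τ ℂ}
    (hK : ∀ s, IsPolynomialFamily (K s)) :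
    IsPolynomialFamily fun x => MvPolynomial.aeval (fun s => K s x) (G x) := by
  obtain ⟨P, hP⟩ := hG
  choose Q hQ using hK
  refine ⟨bind₁ Q P, fun x => ?_⟩
  rw [map_bind₁, ← hP]
  simp only [← hQ]
  rfl

lemma homogeneousComponent (hG : IsPolynomialFamily G) (n : ℕ) :
    IsPolynomialFamily fun x => MvPolynomial.homogeneousComponent n (G x) := by
  obtain ⟨P, hP⟩ := hG
  refine ⟨MvPolynomial.homogeneousComponent n P, fun x => ?_⟩
  ext m
  simp only [hP, coeff_homogeneousComponent, coeff_map]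
  split_ifs <;> simp

lemma reindex (hG : IsPolynomialFamily G) (e : ι → κ) :
    IsPolynomialFamily fun x : κ → ℂ => G (x ∘ e) := by
  obtain ⟨P, hP⟩ := hG
  refine ⟨map (rename (R := ℂ) e : MvPolynomial ι ℂ →+* MvPolynomial κ ℂ) P, fun x => ?_⟩
  simp only [hP, map_map]
  congr 1
  ext <;> simp

lemma isAffineConstructible_eq_zero [Finite ι] (hG : IsPolynomialFamily G) :
    IsAffineConstructible {x | G x = 0} := by
  obtain ⟨P, hP⟩ := hG
  convert IsAffineConstructible.zeros (fun m => coeff m P) using 1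
  ext x
  simp [hP, MvPolynomial.ext_iff, coeff_map]

lemma isAffineConstructible_eq [Finite ι] (hG : IsPolynomialFamily G)
    (hH : IsPolynomialFamily H) : IsAffineConstructible {x | G x = H x} := by
  simpa only [sub_eq_zero] using (hG.sub hH).isAffineConstructible_eq_zero

/-- A polynomial over a field is a unit if and only if it is a nonzero constant. -/
lemma isAffineConstructible_isUnit [Finite ι] (hG : IsPolynomialFamily G) :
    IsAffineConstructible {x | IsUnit (G x)} := by
  convert (hG.isAffineConstructible_eq (hG.homogeneousComponent 0)).inter
    hG.isAffineConstructible_eq_zero.compl using 1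
  ext x
  simp only [Set.mem_inter_iff, Set.mem_compl_iff, Set.mem_ofPred_eq, homogeneousComponent_zero]
  constructor
  · intro h
    refine ⟨?_, h.ne_zero⟩
    obtain ⟨r, -, hr⟩ := isUnit_iff_eq_C_of_isReduced.1 h
    simp [hr]
  · rintro ⟨h, h0⟩
    rw [h] at h0 ⊢
    refine IsUnit.map C (isUnit_iff_ne_zero.2 ?_)
    rintro h1
    simp [h1] at h0

end IsPolynomialFamily

/-- The polynomial with the given coefficients at the exponents in the finite set `T`. -/
def ofCoeffs {T : Finset (σ →₀ ℕ)} (a : T → ℂ) : MvPolynomial σ ℂ :=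
  ∑ m : T, monomial m.1 (a m)

lemma isPolynomialFamily_ofCoeffs (T : Finset (σ →₀ ℕ)) :
    IsPolynomialFamily fun a : T → ℂ => ofCoeffs a := by
  refine IsPolynomialFamily.sum fun m => ?_
  convert (IsPolynomialFamily.coord m).mul (.const (monomial m.1 1)) using 2 with x
  rw [C_mul_monomial, mul_one]

lemma ofCoeffs_smul {T : Finset (σ →₀ ℕ)} (s : ℂ) (a : T → ℂ) :
    ofCoeffs (s • a) = C s * ofCoeffs a := by
  simp [ofCoeffs, Finset.mul_sum, C_mul_monomial]

lemma ofCoeffs_coeff {T : Finset (σ →₀ ℕ)} {p : MvPolynomial σ ℂ} (hp : p.support ⊆ T) :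
    ofCoeffs (fun m : T => coeff m.1 p) = p := by
  rw [ofCoeffs, Finset.sum_coe_sort T fun m => monomial m (coeff m p)]
  conv_rhs => rw [p.as_sum]
  refine (Finset.sum_subset hp fun m _ hm => ?_).symm
  rw [notMem_support_iff.1 hm, monomial_zero]

lemma exists_ofCoeffs_eq_of_totalDegree_le [Finite σ] (D : ℕ) : ∃ T : Finset (σ →₀ ℕ),
    ∀ p : MvPolynomial σ ℂ, p.totalDegree ≤ D → ∃ a : T → ℂ, ofCoeffs a = p := by
  classical
  have := Fintype.ofFinite σ
  refine ⟨Finset.Iic (Finsupp.equivFunOnFinite.symm fun _ => D), fun p hp =>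
    ⟨_, ofCoeffs_coeff fun m hm => ?_⟩⟩
  rw [Finset.mem_Iic]
  intro i
  exact (monomial_le_degreeOf i hm).trans ((degreeOf_le_totalDegree p i).trans hp)

/-- Irreducibility is a constructible condition on the coefficients: the factors in a
factorization of a polynomial of bounded degree have bounded degree, hence finitely many
coefficients. -/
lemma isAffineConstructible_irreducible [Finite σ] (T : Finset (σ →₀ ℕ)) :
    IsAffineConstructible {a : T → ℂ | Irreducible (ofCoeffs a)} := by
  classical
  let D := T.sup fun m => m.sum fun _ e => e
  obtain ⟨T', hT'⟩ := exists_ofCoeffs_eq_of_totalDegree_le (σ := σ) D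
  have hD (a : T → ℂ) : (ofCoeffs a).totalDegree ≤ D := by
    refine totalDegree_finsetSum_le fun m _ => (totalDegree_monomial_le _ _).trans ?_
    exact Finset.le_sup (f := fun m : σ →₀ ℕ => m.sum fun _ e => e) m.2
  let f : (T ⊕ (T' ⊕ T') → ℂ) → MvPolynomial σ ℂ := fun z => ofCoeffs (z ∘ Sum.inl)
  let g : (T ⊕ (T' ⊕ T') → ℂ) → MvPolynomial σ ℂ := fun z => ofCoeffs (z ∘ Sum.inr ∘ Sum.inl)
  let h : (T ⊕ (T' ⊕ T') → ℂ) → MvPolynomial σ ℂ := fun z => ofCoeffs (z ∘ Sum.inr ∘ Sum.inr)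
  have hf : IsPolynomialFamily f := (isPolynomialFamily_ofCoeffs T).reindex _
  have hg : IsPolynomialFamily g := (isPolynomialFamily_ofCoeffs T').reindex _
  have hh : IsPolynomialFamily h := (isPolynomialFamily_ofCoeffs T').reindex _
  convert ((isPolynomialFamily_ofCoeffs T).isAffineConstructible_eq_zero.compl.inter
    (isPolynomialFamily_ofCoeffs T).isAffineConstructible_isUnit.compl).inter
    (IsAffineConstructible.exists ((hf.isAffineConstructible_eq (hg.mul hh)).inter
      (hg.isAffineConstructible_isUnit.compl.inter
        hh.isAffineConstructible_isUnit.compl))).compl using 1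
  ext a
  simp only [Set.mem_inter_iff, Set.mem_compl_iff, Set.mem_ofPred_eq, f, g, h,
    ← Function.comp_assoc, Sum.elim_comp_inl, Sum.elim_comp_inr]
  constructor
  · intro ha
    refine ⟨⟨ha.ne_zero, ha.not_isUnit⟩, ?_⟩
    rintro ⟨y, hy, h1, h2⟩
    exact (ha.isUnit_or_isUnit hy).elim h1 h2
  · rintro ⟨⟨h0, h1⟩, h2⟩
    refine ⟨h1, fun p q hpq => ?_⟩
    -- Both factors have degree at most that of the product, so their coefficients are recorded by
    -- vectors indexed by `T'`.
    by_contra! hcon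
    have hp : p ≠ 0 := by rintro rfl; simp [hpq] at h0
    have hq : q ≠ 0 := by rintro rfl; simp [hpq] at h0
    have hdeg := hD a
    rw [hpq, totalDegree_mul_of_isDomain hp hq] at hdeg
    obtain ⟨b, rfl⟩ := hT' p (by omega)
    obtain ⟨c, rfl⟩ := hT' q (by omega)
    exact h2 ⟨Sum.elim b c, by simpa using hpq, by simpa using hcon⟩

end Families

/-! ### Nodes in terms of homogeneous coordinates -/

section Nodes

variable {ι : Type}

lemma isAffineConstructible_coord_ne_zero [Finite ι] (i : ι) :
    IsAffineConstructible {x : ι → ℂ | x i ≠ 0} := by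
  convert (IsAffineConstructible.zeros fun _ : Unit => (X i : MvPolynomial ι ℂ)).compl using 1
  ext x
  simp

lemma linearIndependent_pair_iff_det_ne_zero (a b : Fin 2 → ℂ) :
    LinearIndependent ℂ ![a, b] ↔ a 0 * b 1 - a 1 * b 0 ≠ 0 := by
  have h := Matrix.linearIndependent_rows_iff_isUnit (A := Matrix.of ![a, b])
  rw [Matrix.isUnit_iff_isUnit_det, isUnit_iff_ne_zero, Matrix.det_fin_two] at h
  exact h

/-- Having an ordinary double point at the origin is a constructible condition: the two linear
factors of the quadratic part are eliminated by Chevalley's theorem. -/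
lemma IsPolynomialFamily.isAffineConstructible_isOrdinaryDoublePoint [Finite ι]
    {G : (ι → ℂ) → MvPolynomial (Fin 2) ℂ} (hG : IsPolynomialFamily G) :
    IsAffineConstructible {x | IsOrdinaryDoublePoint (G x)} := by
  let l (e : Fin 2 → Fin 2 ⊕ Fin 2) (z : ι ⊕ (Fin 2 ⊕ Fin 2) → ℂ) : MvPolynomial (Fin 2) ℂ :=
    ∑ i, C (z (Sum.inr (e i))) * X i
  have hl (e) : IsPolynomialFamily (l e) := .sum fun i => (IsPolynomialFamily.coord _).mul (.const _)
  let Δ : MvPolynomial (ι ⊕ (Fin 2 ⊕ Fin 2)) ℂ :=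
    X (Sum.inr (Sum.inl 0)) * X (Sum.inr (Sum.inr 1)) -
      X (Sum.inr (Sum.inl 1)) * X (Sum.inr (Sum.inr 0))
  have h2 := ((hG.homogeneousComponent 2).reindex
    (Sum.inl : ι → ι ⊕ (Fin 2 ⊕ Fin 2))).isAffineConstructible_eq
    ((hl Sum.inl).mul (hl Sum.inr))
  convert (hG.homogeneousComponent 0).isAffineConstructible_eq_zero.inter
    ((hG.homogeneousComponent 1).isAffineConstructible_eq_zero.inter
      ((IsAffineConstructible.zeros fun _ : Unit => Δ).compl.inter h2).exists) using 1
  ext x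
  simp only [Set.mem_inter_iff, Set.mem_compl_iff, Set.mem_ofPred_eq, IsOrdinaryDoublePoint,
    linearIndependent_pair_iff_det_ne_zero, Sum.elim_comp_inl, l, Δ, Sum.elim_inr, map_sub,
    map_mul, eval_X, forall_const]
  refine and_congr_right fun _ => and_congr_right fun _ => ⟨?_, ?_⟩
  · rintro ⟨a, b, h⟩
    exact ⟨Sum.elim a b, h⟩
  · rintro ⟨y, h⟩
    exact ⟨y ∘ Sum.inl, y ∘ Sum.inr, h⟩

lemma isOrdinaryDoublePoint_C_mul {s : ℂ} (hs : s ≠ 0) {g : MvPolynomial (Fin 2) ℂ}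
    (hg : IsOrdinaryDoublePoint g) : IsOrdinaryDoublePoint (C s * g) := by
  obtain ⟨h0, h1, a, b, hab, h2⟩ := hg
  refine ⟨by rw [homogeneousComponent_C_mul, h0, mul_zero],
    by rw [homogeneousComponent_C_mul, h1, mul_zero], s • a, b, ?_, ?_⟩
  · rw [linearIndependent_pair_iff_det_ne_zero] at hab ⊢
    have : (s • a) 0 * b 1 - (s • a) 1 * b 0 = s * (a 0 * b 1 - a 1 * b 0) := by
      simp only [Pi.smul_apply, smul_eq_mul]
      ring
    rw [this]
    exact mul_ne_zero hs hab
  · simp only [homogeneousComponent_C_mul, h2, Pi.smul_apply, smul_eq_mul, C_mul, mul_assoc,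
      ← Finset.mul_sum]

/-- The polynomial `F` in the affine chart `x_k = 1` of the plane, translated so that the point
with affine coordinates `t` becomes the origin. -/
def translatedChart (F : MvPolynomial (Fin 3) ℂ) (k : Fin 3) (t : Fin 2 → ℂ) :
    MvPolynomial (Fin 2) ℂ :=
  aeval (k.insertNth (α := fun _ => MvPolynomial (Fin 2) ℂ) 1 (fun j => X j + C (t j))) F

/-- The curve `F = 0` has a node at the point of the plane with homogeneous coordinates `q`. -/
def IsNodeAt (F : MvPolynomial (Fin 3) ℂ) (q : Fin 3 → ℂ) : Prop :=
  ∃ k : Fin 3, q k ≠ 0 ∧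
    IsOrdinaryDoublePoint (translatedChart F k fun j => q (k.succAbove j) / q k)

lemma IsNodeAt.ne_zero {F : MvPolynomial (Fin 3) ℂ} {q : Fin 3 → ℂ} (h : IsNodeAt F q) :
    q ≠ 0 := by
  obtain ⟨k, hk, -⟩ := h
  rintro rfl
  exact hk rfl

lemma isNodeAt_smul_iff {s : ℂ} (hs : s ≠ 0) (F : MvPolynomial (Fin 3) ℂ) (q : Fin 3 → ℂ) :
    IsNodeAt F (s • q) ↔ IsNodeAt F q := by
  simp only [IsNodeAt, Pi.smul_apply, smul_eq_mul, mul_div_mul_left _ _ hs, ne_eq, mul_eq_zero, hs,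
    false_or]

lemma IsNodeAt.C_mul {s : ℂ} (hs : s ≠ 0) {F : MvPolynomial (Fin 3) ℂ} {q : Fin 3 → ℂ}
    (h : IsNodeAt F q) : IsNodeAt (C s * F) q := by
  obtain ⟨k, hk, h⟩ := h
  refine ⟨k, hk, ?_⟩
  have := isOrdinaryDoublePoint_C_mul hs h
  rwa [translatedChart, map_mul, aeval_C]

lemma isNodeAt_C_mul_iff {s : ℂ} (hs : s ≠ 0) (F : MvPolynomial (Fin 3) ℂ) (q : Fin 3 → ℂ) :
    IsNodeAt (C s * F) q ↔ IsNodeAt F q := by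
  refine ⟨fun h => ?_, IsNodeAt.C_mul hs⟩
  have := h.C_mul (inv_ne_zero hs)
  rwa [← mul_assoc, ← MvPolynomial.C_mul, inv_mul_cancel₀ hs, C_1, one_mul] at this

lemma isAffineConstructible_isNodeAt (T : Finset (Fin 3 →₀ ℕ)) :
    IsAffineConstructible {v : T ⊕ Fin 3 → ℂ |
      IsNodeAt (ofCoeffs (v ∘ Sum.inl)) (v ∘ Sum.inr)} := by
  -- The affine coordinates `q (k.succAbove j) / q k` are not polynomial functions, so they enter
  -- as auxiliary variables `t j` satisfying `t j * q k = q (k.succAbove j)`.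
  let e : T → (T ⊕ Fin 3) ⊕ Fin 2 := Sum.inl ∘ Sum.inl
  have hloc (k : Fin 3) : IsPolynomialFamily fun z : (T ⊕ Fin 3) ⊕ Fin 2 → ℂ =>
      translatedChart (ofCoeffs (z ∘ e)) k (z ∘ Sum.inr) := by
    let K (i : Fin 3) (z : (T ⊕ Fin 3) ⊕ Fin 2 → ℂ) : MvPolynomial (Fin 2) ℂ :=
      k.insertNth (α := fun _ => MvPolynomial (Fin 2) ℂ) 1 (fun j => X j + C (z (Sum.inr j))) i
    have hK (i : Fin 3) : IsPolynomialFamily (K i) := by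
      induction i using Fin.succAboveCases k with
      | x => simpa [K] using IsPolynomialFamily.const 1
      | p j => simpa [K] using (IsPolynomialFamily.const (X j)).add (.coord _)
    exact ((isPolynomialFamily_ofCoeffs T).reindex e).aeval hK
  let f (k : Fin 3) (j : Fin 2) : MvPolynomial ((T ⊕ Fin 3) ⊕ Fin 2) ℂ :=
    X (Sum.inr j) * X (Sum.inl (Sum.inr k)) - X (Sum.inl (Sum.inr (k.succAbove j)))
  convert IsAffineConstructible.iUnion fun k : Fin 3 =>
    (isAffineConstructible_coord_ne_zero (Sum.inr k)).inter
      ((IsAffineConstructible.zeros (f k)).inter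
        (hloc k).isAffineConstructible_isOrdinaryDoublePoint).exists using 1
  ext v
  simp only [Set.mem_iUnion, Set.mem_inter_iff, Set.mem_ofPred_eq, IsNodeAt, f, e, map_sub, map_mul,
    eval_X, Sum.elim_inl, Sum.elim_inr, Sum.elim_comp_inr, ← Function.comp_assoc,
    Sum.elim_comp_inl, sub_eq_zero]
  refine exists_congr fun k => and_congr_right fun hk => ⟨fun h => ⟨_, fun j => ?_, h⟩, ?_⟩
  · exact div_mul_cancel₀ _ hk
  · rintro ⟨t, ht, h⟩
    convert h using 2
    funext j
    exact ((eq_div_iff hk).2 (ht j)).symm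

end Nodes

/-! ### The cones over the sets of nodal curves -/

section Cones

variable {d n : ℕ}

/-- The homogeneous coordinates of the `i`-th point. -/
def pointCoords (v : Exponent d ⊕ (Fin n × Fin 3) → ℂ) (i : Fin n) : Fin 3 → ℂ :=
  fun j => v (Sum.inr (i, j))

/-- Homogeneous coordinates of irreducible curves together with `n` distinct nodes. Points are
distinct when their coordinate vectors are not proportional. -/
def coneH (d n : ℕ) : Set (Exponent d ⊕ (Fin n × Fin 3) → ℂ) :=
  {v | Irreducible (ofCoeffs (v ∘ Sum.inl)) ∧
    (∀ i, IsNodeAt (ofCoeffs (v ∘ Sum.inl)) (pointCoords v i)) ∧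
    ∀ i j, i ≠ j → ¬∃ s : ℂ, s • pointCoords v j = pointCoords v i}

/-- Coefficient vectors of irreducible curves with at least `n` nodes. -/
def coneB (d n : ℕ) : Set (Exponent d → ℂ) :=
  {c | ∃ y : Fin n × Fin 3 → ℂ, Sum.elim c y ∈ coneH d n}

lemma isAffineConstructible_proportional {ι κ : Type} [Finite ι] (a b : κ → ι) :
    IsAffineConstructible {v : ι → ℂ | ∃ s : ℂ, s • (v ∘ a) = v ∘ b} := by
  convert (IsAffineConstructible.zeros fun k : κ =>
    (X (Sum.inr ()) * X (Sum.inl (a k)) - X (Sum.inl (b k)) :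
      MvPolynomial (ι ⊕ Unit) ℂ)).exists using 1
  ext v
  simp only [Set.mem_ofPred_eq, funext_iff, map_sub, map_mul, eval_X, Sum.elim_inl, Sum.elim_inr,
    sub_eq_zero]
  exact ⟨fun ⟨s, hs⟩ => ⟨fun _ => s, hs⟩, fun ⟨y, hy⟩ => ⟨y (), hy⟩⟩

lemma isAffineConstructible_coneH (d n : ℕ) : IsAffineConstructible (coneH d n) := by
  have h1 := (isAffineConstructible_irreducible
    ((Finset.univ : Finset (Fin 3)).finsuppAntidiag d)).reindex
    (Sum.inl : Exponent d → Exponent d ⊕ (Fin n × Fin 3))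
  have h2 (i : Fin n) := (isAffineConstructible_isNodeAt
    ((Finset.univ : Finset (Fin 3)).finsuppAntidiag d)).reindex
    (Sum.map id fun j => (i, j) : Exponent d ⊕ Fin 3 → Exponent d ⊕ (Fin n × Fin 3))
  have h3 (p : {p : Fin n × Fin n // p.1 ≠ p.2}) := (isAffineConstructible_proportional
    (fun j : Fin 3 => (Sum.inr (p.1.2, j) : Exponent d ⊕ (Fin n × Fin 3)))
    (fun j : Fin 3 => Sum.inr (p.1.1, j))).compl
  convert h1.inter ((IsAffineConstructible.iInter h2).inter (.iInter h3)) using 1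
  ext v
  simp only [Set.mem_inter_iff, Set.mem_iInter, Subtype.forall, Prod.forall]
  rfl

lemma isAffineConstructible_coneB (d n : ℕ) : IsAffineConstructible (coneB d n) :=
  (isAffineConstructible_coneH d n).exists

/-- Membership in `coneH` does not depend on the choice of homogeneous coordinates of the curve and
of the points. -/
lemma mem_coneH_scale_iff {v v' : Exponent d ⊕ (Fin n × Fin 3) → ℂ} {s : ℂ} {t : Fin n → ℂ}
    (hs : s ≠ 0) (ht : ∀ i, t i ≠ 0) (hv : v' ∘ Sum.inl = s • (v ∘ Sum.inl))
    (hq : ∀ i, pointCoords v' i = t i • pointCoords v i) :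
    v' ∈ coneH d n ↔ v ∈ coneH d n := by
  simp only [coneH, Set.mem_ofPred_eq, hv, hq, ofCoeffs_smul]
  refine and_congr ?_ (and_congr ?_ ?_)
  · exact irreducible_isUnit_mul ((isUnit_iff_ne_zero.2 hs).map C)
  · simp only [isNodeAt_C_mul_iff hs, isNodeAt_smul_iff (ht _)]
  · refine forall₂_congr fun i j => imp_congr_right fun _ => not_congr ⟨?_, ?_⟩
    · rintro ⟨a, ha⟩
      refine ⟨(t i)⁻¹ * a * t j, ?_⟩
      rw [mul_smul, mul_smul, ha, inv_smul_smul₀ (ht i)]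
    · rintro ⟨a, ha⟩
      refine ⟨t i * a * (t j)⁻¹, ?_⟩
      rw [mul_smul, inv_smul_smul₀ (ht j), mul_smul, ha]

lemma mem_coneB_smul_iff {s : ℂ} (hs : s ≠ 0) (c : Exponent d → ℂ) :
    s • c ∈ coneB d n ↔ c ∈ coneB d n := by
  refine exists_congr fun y => mem_coneH_scale_iff (t := 1) hs (by simp) ?_ fun i => ?_
  · simp
  · exact (one_smul ℂ _).symm

lemma natCast_le_encard_iff_exists_injective {α : Type*} (S : Set α) (n : ℕ) :
    (n : ℕ∞) ≤ S.encard ↔ ∃ p : Fin n → α, Function.Injective p ∧ ∀ i, p i ∈ S := by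
  constructor
  · intro h
    obtain ⟨t, htS, ht⟩ := Set.exists_subset_encard_eq h
    have hfin : t.Finite := Set.finite_of_encard_eq_coe ht
    have hcard : Nat.card t = n := by
      rw [Nat.card_coe_set_eq, Set.ncard, ht, ENat.toNat_natCast]
    have := hfin.to_subtype
    let e := (Finite.equivFinOfCardEq hcard).symm
    exact ⟨fun i => e i, Subtype.val_injective.comp e.injective, fun i => htS (e i).2⟩
  · rintro ⟨p, hp, hpS⟩
    calc (n : ℕ∞) = ENat.card (Fin n) := by simp
      _ ≤ (Set.range p).encard := hp.encard_range
      _ ≤ S.encard := Set.encard_le_encard (Set.range_subset_iff.2 hpS)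

lemma mem_setB_iff (C : CurveSpace d) : C ∈ setB d n ↔ ∃ p, (C, p) ∈ setH d n := by
  constructor
  · intro h
    obtain ⟨p, hp⟩ := (natCast_le_encard_iff_exists_injective _ _).1 h.2
    exact ⟨p, h, hp⟩
  · rintro ⟨p, h, -⟩
    exact h

lemma mem_setH_iff (x : IncidenceSpace d n) : x ∈ setH d n ↔ x.coords ∈ coneH d n := by
  have hinj : Function.Injective x.2 ↔
      ∀ i j, i ≠ j → ¬∃ s : ℂ, s • pointCoords x.coords j = pointCoords x.coords i := by
    have h (i j : Fin n) : x.2 i = x.2 j ↔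
        ∃ s : ℂ, s • pointCoords x.coords j = pointCoords x.coords i := by
      conv_lhs => rw [← (x.2 i).mk_rep, ← (x.2 j).mk_rep]
      exact Projectivization.mk_eq_mk_iff' ..
    simp only [← h]
    exact ⟨fun hx i j hij h => hij (hx h), fun hx i j h => by_contra fun hij => hx i j hij h⟩
  constructor
  · rintro ⟨hB, hx, hn⟩
    exact ⟨hB.1, hn, hinj.1 hx⟩
  · rintro ⟨hI, hn, hx⟩
    have hx' := hinj.2 hx
    exact ⟨⟨hI, (natCast_le_encard_iff_exists_injective _ _).2 ⟨x.2, hx', hn⟩⟩, hx', hn⟩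

lemma mem_setB_iff_mem_coneB (C : CurveSpace d) : C ∈ setB d n ↔ C.coeffs ∈ coneB d n := by
  rw [mem_setB_iff]
  constructor
  · rintro ⟨p, hp⟩
    exact ⟨_, (mem_setH_iff (C, p)).1 hp⟩
  · rintro ⟨y, hy⟩
    have hne (i : Fin n) : pointCoords (Sum.elim C.coeffs y) i ≠ 0 := (hy.2.1 i).ne_zero
    choose a ha using fun i => Projectivization.exists_smul_eq_mk_rep ℂ _ (hne i)
    refine ⟨fun i => .mk ℂ _ (hne i), (mem_setH_iff _).2 ?_⟩
    refine (mem_coneH_scale_iff (s := 1) (t := fun i => a i) one_ne_zero (fun i => (a i).ne_zero)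
      ?_ fun i => ?_).2 hy
    · rw [one_smul]
      rfl
    · exact (ha i).symm

end Cones

/-! ### Constructibility -/

section Constructible

variable {d n : ℕ}

/-- The charts are given by the nonvanishing of a single coefficient. -/
lemma CurveSpace.isConstructible_of_cone {S : Set (CurveSpace d)} {Ŝ : Set (Exponent d → ℂ)}
    (hŜ : IsAffineConstructible Ŝ) (hscale : ∀ s : ℂ, s ≠ 0 → ∀ c, s • c ∈ Ŝ ↔ c ∈ Ŝ)
    (hS : ∀ C : CurveSpace d, C ∈ S ↔ C.coeffs ∈ Ŝ) : Topology.IsConstructible S := by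
  refine isConstructible_of_charts (J := Exponent d) (W := fun _ => 1) (u := X) (G := fun _ => X)
    (fun m => isWeightedHomogeneous_X _ _ _) (fun _ m => isWeightedHomogeneous_X _ _ _) ?_ hŜ ?_
  · intro C
    obtain ⟨m, hm⟩ := Function.ne_iff.1 (Projectivization.rep_nonzero (K := ℂ) C)
    exact ⟨m, by rw [eval_X]; exact hm⟩
  · intro C m hm
    rw [hS, ← hscale _ (inv_ne_zero hm)]
    simp only [eval_X, div_eq_inv_mul]
    rfl

lemma IncidenceSpace.isConstructible_of_cone {S : Set (IncidenceSpace d n)}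
    {Ŝ : Set (Exponent d ⊕ (Fin n × Fin 3) → ℂ)} (hŜ : IsAffineConstructible Ŝ)
    (hscale : ∀ (s : ℂ) (t : Fin n → ℂ), s ≠ 0 → (∀ i, t i ≠ 0) → ∀ v v',
      v' ∘ Sum.inl = s • (v ∘ Sum.inl) → (∀ i, pointCoords v' i = t i • pointCoords v i) →
        (v' ∈ Ŝ ↔ v ∈ Ŝ))
    (hS : ∀ x : IncidenceSpace d n, x ∈ S ↔ x.coords ∈ Ŝ) : Topology.IsConstructible S := by
  classical
  -- The chart `(m, k)` is where the coefficient at `m` and, for each `i`, the coordinate `k i` of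
  -- the `i`-th point do not vanish. All numerators are brought to the common denominator
  -- `c_m ∏ i, (x_i)_(k i)`.
  let Q (k : Fin n → Fin 3) : MvPolynomial (Exponent d ⊕ (Fin n × Fin 3)) ℂ :=
    ∏ i, X (Sum.inr (i, k i))
  have hQ (k) : IsWeightedHomogeneous (IncidenceSpace.weight d n) (Q k)
      (∑ i, (0, Pi.single i 1)) :=
    IsWeightedHomogeneous.prod _ _ _ fun i _ =>
      isWeightedHomogeneous_X ℂ (IncidenceSpace.weight d n) (Sum.inr (i, k i))
  have hX (m : Exponent d) : IsWeightedHomogeneous (IncidenceSpace.weight d n)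
      (X (Sum.inl m) : MvPolynomial _ ℂ) (1, 0) :=
    isWeightedHomogeneous_X ℂ (IncidenceSpace.weight d n) (Sum.inl m)
  have hQu (k : Fin n → Fin 3) (i : Fin n) (j : Fin 3) (x : IncidenceSpace d n) :
      eval x.coords (Q (Function.update k i j)) * x.coords (Sum.inr (i, k i)) =
        eval x.coords (Q k) * x.coords (Sum.inr (i, j)) := by
    simp only [Q, map_prod, eval_X]
    rw [← Finset.mul_prod_erase _ _ (Finset.mem_univ i),
      ← Finset.mul_prod_erase _ _ (Finset.mem_univ i), Function.update_self,
      Finset.prod_congr rfl fun a ha => by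
        rw [Function.update_of_ne (Finset.ne_of_mem_erase ha)]]
    ring
  refine isConstructible_of_charts (J := Exponent d × (Fin n → Fin 3))
    (W := fun _ => (1, 0) + ∑ i, (0, Pi.single i 1)) (u := fun c => X (Sum.inl c.1) * Q c.2)
    (G := fun c => Sum.elim (fun m => X (Sum.inl m) * Q c.2)
      (fun q => X (Sum.inl c.1) * Q (Function.update c.2 q.1 q.2)))
    (fun c => (hX _).mul (hQ _)) ?_ ?_ hŜ ?_
  · rintro c (m | q)
    · exact (hX _).mul (hQ _)
    · exact (hX _).mul (hQ _)
  · intro x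
    obtain ⟨m, hm⟩ := Function.ne_iff.1 (Projectivization.rep_nonzero (K := ℂ) x.1)
    choose k hk using fun i => Function.ne_iff.1 (Projectivization.rep_nonzero (x.2 i))
    refine ⟨(m, k), ?_⟩
    simp only [Q, map_mul, map_prod, eval_X]
    exact mul_ne_zero hm (Finset.prod_ne_zero_iff.2 fun i _ => hk i)
  · rintro x ⟨m, k⟩ hu
    simp only [map_mul, eval_X] at hu
    obtain ⟨hm, hk⟩ := mul_ne_zero_iff.1 hu
    have hk' (i : Fin n) : x.coords (Sum.inr (i, k i)) ≠ 0 := by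
      simp only [Q, map_prod, eval_X] at hk
      exact Finset.prod_ne_zero_iff.1 hk i (Finset.mem_univ i)
    rw [hS]
    refine (hscale (x.coords (Sum.inl m))⁻¹ (fun i => (x.coords (Sum.inr (i, k i)))⁻¹)
      (inv_ne_zero hm) (fun i => inv_ne_zero (hk' i)) _ _ ?_ fun i => ?_).symm
    · funext m'
      simp only [Function.comp_apply, Sum.elim_inl, map_mul, eval_X, Pi.smul_apply, smul_eq_mul]
      field_simp
    · funext j
      simp only [pointCoords, Sum.elim_inr, map_mul, eval_X, Pi.smul_apply, smul_eq_mul]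
      rw [mul_div_mul_left _ _ hm, ← div_eq_inv_mul, div_eq_div_iff hk (hk' i), hQu, mul_comm]

lemma isConstructible_setB (d n : ℕ) : Topology.IsConstructible (setB d n) :=
  CurveSpace.isConstructible_of_cone (isAffineConstructible_coneB d n)
    (fun _ hs c => mem_coneB_smul_iff hs c) mem_setB_iff_mem_coneB

lemma isConstructible_setH (d n : ℕ) : Topology.IsConstructible (setH d n) :=
  IncidenceSpace.isConstructible_of_cone (isAffineConstructible_coneH d n)
    (fun _ _ hs ht _ _ hv hq => mem_coneH_scale_iff hs ht hv hq) mem_setH_iff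

lemma setD_eq (d n : ℕ) : setD d n = setB d n \ setB d (n + 1) := by
  ext C
  simp only [setD, setB, Set.mem_sdiff, Set.mem_ofPred_eq, Nat.cast_add, Nat.cast_one]
  have : C.nodes.encard = n ↔ (n : ℕ∞) ≤ C.nodes.encard ∧ ¬((n : ℕ∞) + 1 ≤ C.nodes.encard) := by
    rw [not_le, ENat.lt_add_one_iff (ENat.natCast_ne_top n), le_antisymm_iff, and_comm]
  rw [this]
  tauto

lemma isConstructible_setD (d n : ℕ) : Topology.IsConstructible (setD d n) := by
  rw [setD_eq]
  exact (isConstructible_setB d n).sdiff (isConstructible_setB d (n + 1))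

lemma isConstructible_setK (d n : ℕ) : Topology.IsConstructible (setK d n) := by
  refine IncidenceSpace.isConstructible_of_cone ((isAffineConstructible_coneH d n).inter
    ((isAffineConstructible_coneB d (n + 1)).reindex Sum.inl).compl) ?_ ?_
  · intro s t hs ht v v' hv hq
    simp only [Set.mem_inter_iff, Set.mem_compl_iff, Set.mem_ofPred_eq, hv, mem_coneB_smul_iff hs,
      mem_coneH_scale_iff hs ht hv hq]
  · intro x
    have hx : x.coords ∘ Sum.inl ∈ coneB d (n + 1) ↔ x.1 ∈ setB d (n + 1) :=
      (mem_setB_iff_mem_coneB x.1).symm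
    simp only [Set.mem_inter_iff, Set.mem_compl_iff, Set.mem_ofPred_eq, ← mem_setH_iff, hx, setK,
      setD_eq, setH, Set.mem_sdiff]
    tauto

end Constructible

end PlaneNodal

end

theorem mainTheorem6 (d n : ℕ) :
    Topology.IsConstructible (PlaneNodal.setH d n) ∧
    Topology.IsConstructible (PlaneNodal.setK d n) ∧
    Topology.IsConstructible (PlaneNodal.setB d n) ∧
    Topology.IsConstructible (PlaneNodal.setD d n) :=
  ⟨PlaneNodal.isConstructible_setH d n, PlaneNodal.isConstructible_setK d n,
    PlaneNodal.isConstructible_setB d n, PlaneNodal.isConstructible_setD d n⟩
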